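/- A \emph{solution} is a set $X$ with maps $\sigma,\tau\colon X\times X\to X$, written $\sigma_x=\sigma(x,\cdot)$ and $\tau_y=\tau(\cdot,y)$, such that all $\sigma_x$ and $\tau_y$ are bijections of $X$ and the map $r\colon X^2\to X^2$, $r(x,y)=(\sigma_x(y),\tau_y(x))$, satisfies $r^2=\mathrm{id}$ and the braid relation $(\mathrm{id}\times r)(r\times\mathrm{id})(\mathrm{id}\times r)=(r\times\mathrm{id})(\mathrm{id}\times r)(r\times\mathrm{id})$. Its retraction $\mathrm{Ret}(X)$ is the induced solution on the quotient of $X$ by the relation $x\sim y\Leftrightarrow\tau_x=\tau_y$. The solution has \emph{multipermutation level $2$} if $|\mathrm{Ret}(X)|\neq 1$ and $|\mathrm{Ret}(\mathrm{Ret}(X))|=1$. Put $\mathcal G(X)=\langle\sigma_x : x\in X\rangle$ and $\mathrm{Dis}(X)=\langle\sigma_x\sigma_y^{-1} : x,y\in X\rangle$, subgroups of the symmetric group of $X$; a subscript $e\in X$ denotes the stabilizer of $e$. The solution is \emph{indecomposable} if $\mathcal G(X)$ is transitive on $X$. An isomorphism $(X,\sigma,\tau)\to(X',\sigma',\tau')$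 is a bijection $\Phi\colon X\to X'$ with $\Phi\sigma_x=\sigma'_{\Phi(x)}\Phi$ for all $x\in X$. Let $p$ be a prime, let $k\ge 1$ and $m\ge 1$ be integers, and let $A$ be an elementary abelian group of order $p^k$. Then the number $\mathfrak n(A,m)$ of isomorphism classes of indecomposable solutions $(X,\sigma,\tau)$ of multipermutation level $2$ such that, for $e\in X$ (the choice of $e$ being immaterial), $\mathrm{Dis}(X)/\mathrm{Dis}(X)_e\cong A$ and $[\mathcal G(X):\mathcal G(X)_e\,\mathrm{Dis}(X)]=m$, is finite and equals $$\mathfrak n(A,m)=\begin{cases}p^k\cdot\dfrac{(p^{m-1}-1)(p^{m-2}-1)\cdots(p^{k+1}-1)}{(p^{m-k-1}-1)(p^{m-k-2}-1)\cdots(p-1)} & \text{if } m>k+1,\\[2mm] p^k & \text{if } m=k+1,\\ 0 & \text{if } m\le k.\end{cases}$$ -/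

import Mathlib

universe u v

namespace YB

/-- A (set-theoretic, non-degenerate, involutive) solution of the Yang-Baxter equation on a set
`X`: `r (x, y) = (σ x y, τ y x)`, that is `σ x = σ(x, _)` and `τ y = τ(_, y)`. -/
structure Solution (X : Type u) where
  /-- `σ x y` is the first component of `r (x, y)`. -/
  σ : X → X → X
  /-- `τ y x` is the second component of `r (x, y)`. -/
  τ : X → X → X
  /-- every `σ x` is a bijection -/
  bij_σ : ∀ x, Function.Bijective (σ x)
  /-- every `τ y` is a bijection -/
  bij_τ : ∀ y, Function.Bijective (τ y)
  /-- `r ∘ r = id` -/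
  invol : ∀ x y, (σ (σ x y) (τ y x), τ (τ y x) (σ x y)) = (x, y)
  /-- first component of the braid relation `r₂ r₁ r₂ = r₁ r₂ r₁`, evaluated at `(x, y, z)` -/
  braid₁ : ∀ x y z, σ x (σ y z) = σ (σ x y) (σ (τ y x) z)
  /-- second component of the braid relation -/
  braid₂ : ∀ x y z, σ (τ (σ y z) x) (τ z y) = τ (σ (τ y x) z) (σ x y)
  /-- third component of the braid relation -/
  braid₃ : ∀ x y z, τ (τ z y) (τ (σ y z) x) = τ z (τ y x)

namespace Solution

variable {X : Type u} (S : Solution X)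

/-- The map `r : X × X → X × X` of the solution. -/
def r (q : X × X) : X × X := (S.σ q.1 q.2, S.τ q.2 q.1)

/-- The map `r × id` on triples. -/
def r₁ (t : X × X × X) : X × X × X :=
  ((S.r (t.1, t.2.1)).1, (S.r (t.1, t.2.1)).2, t.2.2)

/-- The map `id × r` on triples. -/
def r₂ (t : X × X × X) : X × X × X := (t.1, S.r t.2)

/-- The three component identities of the structure are the braid relation. -/
theorem braid_relation (t : X × X × X) : S.r₂ (S.r₁ (S.r₂ t)) = S.r₁ (S.r₂ (S.r₁ t)) := by
  obtain ⟨x, y, z⟩ := t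
  simp only [r₁, r₂, r, Prod.mk.injEq]
  exact ⟨S.braid₁ x y z, S.braid₂ x y z, S.braid₃ x y z⟩

theorem σ_σ_τ (x y : X) : S.σ (S.σ x y) (S.τ y x) = x := congrArg Prod.fst (S.invol x y)

theorem τ_τ_σ (x y : X) : S.τ (S.τ y x) (S.σ x y) = y := congrArg Prod.snd (S.invol x y)

/-- The retraction relation `x ∼ y ↔ τ(_, x) = τ(_, y)`. -/
def retSetoid : Setoid X where
  r x y := S.τ x = S.τ y
  iseqv := ⟨fun _ => rfl, fun h => h.symm, fun h h' => h.trans h'⟩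

/-- The relation `∼` can be read off from `σ` as well. -/
theorem τ_eq_iff {x y : X} : S.τ x = S.τ y ↔ S.σ x = S.σ y := by
  -- the diagonal-like maps `U x = σ_x⁻¹ x` and `T y = τ_y⁻¹ y` are inverse to each other
  choose U hU using fun x => (S.bij_σ x).2 x
  choose T hT using fun y => (S.bij_τ y).2 y
  have hτU : ∀ x, S.τ (U x) x = U x := fun x => (S.bij_σ x).1 (by
    have h := S.σ_σ_τ x (U x)
    rw [hU] at h
    rw [h, hU])
  have hσT : ∀ y, S.σ (T y) y = T y := fun y => (S.bij_τ y).1 (by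
    have h := S.τ_τ_σ (T y) y
    rw [hT] at h
    rw [h, hT])
  have hTU : ∀ x, T (U x) = x := fun x => (S.bij_τ (U x)).1 (by rw [hT, hτU])
  have hUT : ∀ y, U (T y) = y := fun y => (S.bij_σ (T y)).1 (by rw [hU, hσT])
  have key : ∀ x z, S.σ x (U (S.τ x z)) = U z := fun x z => (S.bij_σ z).1 (by
    rw [hU, S.braid₁, hU, S.σ_σ_τ])
  have key' : ∀ x w, S.τ x (T (S.σ x w)) = T w := fun x w => (S.bij_τ w).1 (by
    rw [hT, ← S.braid₃, hT, S.τ_τ_σ])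
  constructor
  · intro h
    funext w
    have hx := key' x w
    have hy := key' y w
    rw [h] at hx
    have := (S.bij_τ y).1 (hx.trans hy.symm)
    simpa only [hUT] using congrArg U this
  · intro h
    funext z
    have hx := key x z
    have hy := key y z
    rw [h] at hx
    have := (S.bij_σ y).1 (hx.trans hy.symm)
    simpa only [hTU] using congrArg T this

theorem τ_σ_congr {x x' y y' : X} (hx : S.τ x = S.τ x') (hy : S.τ y = S.τ y') :
    S.τ (S.σ x y) = S.τ (S.σ x' y') := by
  rw [S.τ_eq_iff.1 hx, S.τ_eq_iff]
  funext w
  obtain ⟨z, rfl⟩ := (S.bij_σ (S.τ y x')).2 w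
  rw [← S.braid₁, hy, ← S.braid₁, S.τ_eq_iff.1 hy]

theorem τ_τ_congr {x x' y y' : X} (hx : S.τ x = S.τ x') (hy : S.τ y = S.τ y') :
    S.τ (S.τ x y) = S.τ (S.τ x' y') := by
  rw [hx]
  funext w
  obtain ⟨z, rfl⟩ := (S.bij_τ (S.σ y x')).2 w
  rw [S.braid₃, hy, S.τ_eq_iff.1 hy, S.braid₃]

theorem σ_cancel {x y y' : X} (h : S.τ (S.σ x y) = S.τ (S.σ x y')) : S.τ y = S.τ y' := by
  have hσ := S.τ_eq_iff.1 h
  have hτ : S.τ y x = S.τ y' x := (S.bij_σ (S.σ x y)).1 (by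
    rw [S.σ_σ_τ, hσ, S.σ_σ_τ])
  rw [S.τ_eq_iff]
  funext z
  exact (S.bij_σ x).1 (by rw [S.braid₁ x y z, S.braid₁ x y' z, hσ, hτ])

theorem τ_cancel {x y y' : X} (h : S.τ (S.τ x y) = S.τ (S.τ x y')) : S.τ y = S.τ y' := by
  have hσ : S.σ y x = S.σ y' x := (S.bij_τ (S.τ x y)).1 (by
    rw [S.τ_τ_σ, h, S.τ_τ_σ])
  funext z
  exact (S.bij_τ x).1 (by rw [← S.braid₃ z y x, ← S.braid₃ z y' x, h, hσ])

/-- The underlying set `X/∼` of the retraction. -/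
def RetSet : Type u := Quotient S.retSetoid

/-- The retraction `Ret(X)`: the quotient of the solution by `∼`, with the induced operations. -/
def ret : Solution S.RetSet where
  σ := Quotient.map₂ S.σ fun _ _ hx _ _ hy => S.τ_σ_congr hx hy
  τ := Quotient.map₂ S.τ fun _ _ hx _ _ hy => S.τ_τ_congr hx hy
  bij_σ := by
    rintro ⟨x⟩
    constructor
    · rintro ⟨y⟩ ⟨y'⟩ h
      exact Quotient.sound (S.σ_cancel (Quotient.exact h))
    · rintro ⟨y⟩
      obtain ⟨z, hz⟩ := (S.bij_σ x).2 y
      exact ⟨Quotient.mk _ z, congrArg (Quotient.mk S.retSetoid) hz⟩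
  bij_τ := by
    rintro ⟨x⟩
    constructor
    · rintro ⟨y⟩ ⟨y'⟩ h
      exact Quotient.sound (S.τ_cancel (Quotient.exact h))
    · rintro ⟨y⟩
      obtain ⟨z, hz⟩ := (S.bij_τ x).2 y
      exact ⟨Quotient.mk _ z, congrArg (Quotient.mk S.retSetoid) hz⟩
  invol := by
    rintro ⟨x⟩ ⟨y⟩
    exact Prod.ext (congrArg (Quotient.mk S.retSetoid) (S.σ_σ_τ x y))
      (congrArg (Quotient.mk S.retSetoid) (S.τ_τ_σ x y))
  braid₁ := by
    rintro ⟨x⟩ ⟨y⟩ ⟨z⟩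
    exact congrArg (Quotient.mk S.retSetoid) (S.braid₁ x y z)
  braid₂ := by
    rintro ⟨x⟩ ⟨y⟩ ⟨z⟩
    exact congrArg (Quotient.mk S.retSetoid) (S.braid₂ x y z)
  braid₃ := by
    rintro ⟨x⟩ ⟨y⟩ ⟨z⟩
    exact congrArg (Quotient.mk S.retSetoid) (S.braid₃ x y z)

/-- Permutation solutions (multipermutation level 1): `|Ret(X)| = 1`. -/
def IsPermutational : Prop := Nat.card S.RetSet = 1

/-- Multipermutation level 2: not a permutation solution, and `|Ret(Ret(X))| = 1`. -/
def IsLevelTwo : Prop := ¬ S.IsPermutational ∧ S.ret.IsPermutational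

/-- `σ x` as a permutation of `X`. -/
noncomputable def σPerm (x : X) : Equiv.Perm X := Equiv.ofBijective (S.σ x) (S.bij_σ x)

/-- The permutation group `𝒢(X)`, generated by all `σ x`. -/
def permGroup : Subgroup (Equiv.Perm X) := Subgroup.closure (Set.range S.σPerm)

/-- The displacement group `Dis(X)`, generated by all `σ x * (σ y)⁻¹`. -/
def dis : Subgroup (Equiv.Perm X) :=
  Subgroup.closure {g | ∃ x y, g = S.σPerm x * (S.σPerm y)⁻¹}

/-- A solution is indecomposable if its permutation group acts transitively on `X`. -/
def IsIndecomposable : Prop := MulAction.IsPretransitive S.permGroup X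

/-- `Dis(X)_e` is normal in `Dis(X)` and the quotient group is isomorphic to `A`. -/
def DisQuotientIso (e : X) (A : Type v) [AddCommGroup A] : Prop :=
  ∃ _ : (MulAction.stabilizer S.dis e).Normal,
    Nonempty ((S.dis ⧸ MulAction.stabilizer S.dis e) ≃* Multiplicative A)

/-- The subgroup `𝒢(X)_e Dis(X)` of `𝒢(X)`, as the join of the stabilizer `𝒢(X)_e` and `Dis(X)`
(this is the set of products, because `Dis(X)` is normal in `𝒢(X)`). -/
def stabDis (e : X) : Subgroup S.permGroup :=
  MulAction.stabilizer S.permGroup e ⊔ S.dis.subgroupOf S.permGroup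

/-- An isomorphism of solutions: a bijection `Φ` with `Φ ∘ σ x = σ' (Φ x) ∘ Φ` for all `x`. -/
def IsIso {Y : Type u} (S : Solution X) (S' : Solution Y) : Prop :=
  ∃ Φ : X ≃ Y, ∀ x y, Φ (S.σ x y) = S'.σ (Φ x) (Φ y)

end Solution

/-- The indecomposable solutions of multipermutation level 2 such that
`Dis(X)/Dis(X)_e ≅ A` and `[𝒢(X) : 𝒢(X)_e Dis(X)] = m`, where `e ∈ X`
(by transitivity of `𝒢(X)` the choice of `e` does not matter). -/
structure IndecSol (A : Type v) [AddCommGroup A] (m : ℕ) where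
  /-- the underlying set -/
  X : Type u
  /-- the solution -/
  S : Solution X
  indec : S.IsIndecomposable
  level : S.IsLevelTwo
  inv : ∃ e : X, S.DisQuotientIso e A ∧ (S.stabDis e).index = m

/-- Isomorphism of solutions as an equivalence relation. -/
def isoSetoid (A : Type v) [AddCommGroup A] (m : ℕ) : Setoid (IndecSol.{u, v} A m) where
  r P Q := P.S.IsIso Q.S
  iseqv :=
    { refl := fun _ => ⟨Equiv.refl _, fun _ _ => rfl⟩
      symm := by
        rintro P Q ⟨Φ, h⟩
        refine ⟨Φ.symm, fun x y => ?_⟩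
        rw [Equiv.symm_apply_eq, h]
        simp
      trans := by
        rintro P Q R ⟨Φ, h⟩ ⟨Ψ, h'⟩
        exact ⟨Φ.trans Ψ, fun x y => by simp [h, h']⟩ }

/-- The isomorphism classes of the solutions in `IndecSol A m`. -/
def IsoClasses (A : Type v) [AddCommGroup A] (m : ℕ) : Type (u + 1) :=
  Quotient (isoSetoid.{u, v} A m)

end YB

/-! At level 2 all `σ x` induce one and the same bijection of `Ret(X)`, and `σ x` depends only on
the class of `x`. The braid relation then reads σ_x σ_y = σ_{u·y} σ_{v⁻¹·x} for arbitrary `u`, `v`.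
Hence `Dis(X)` is abelian, is normal in `𝒢(X)`, and acts trivially on `Ret(X)`; modulo `Dis(X)`
every element of `𝒢(X)` is a power of one `σ e`.

If `X` is indecomposable, its `Dis(X)`-orbits form a cycle of length `m`, and each is a torsor under
a group `B ≅ A`. Transporting coordinates along the cycle by a path of `σ`'s identifies `X` with a
model on `B × ZMod m` in which `(b, i)` sends `(a, j)` to `(a + d (i - j) + wrap c j, j + 1)`. Here
`d 0 = 0`, the values of `d` generate `B`, and `c` is the arbitrary defect of closing the path
(`exists_model_isIso`).

Two models are isomorphic exactly when an automorphism of `B` carries `(d, c)` to `(d', c')`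
(`model_isIso`, `exists_addEquiv_of_model_isIso`). Since `d` generates, `Aut B` acts freely, so the
number of classes times |GL_k(F_p)| is the number of generating `d` times p^k. Read as k × (m - 1)
matrices, generating `d` are those of rank `k`, that is, linearly independent k-tuples in F_p^(m-1).
The quotient is p^k times a Gaussian binomial coefficient. -/

namespace YB
namespace Solution

variable {X : Type u} (S : Solution X)

@[simp] theorem σPerm_apply (x y : X) : S.σPerm x y = S.σ x y := rfl

theorem σPerm_eq_iff {x y : X} : S.σPerm x = S.σPerm y ↔ S.τ x = S.τ y := by
  rw [S.τ_eq_iff]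
  exact ⟨fun h => funext fun z => by simpa using congrArg (fun g : Equiv.Perm X => g z) h,
    fun h => Equiv.ext fun z => congrFun h z⟩

/-! ### Level 2: the displacement group is abelian and acts trivially on the retraction. -/

section LevelTwo

variable {S} (h : S.ret.IsPermutational)
include h

theorem τ_σ_eq (x y z : X) : S.τ (S.σ x z) = S.τ (S.σ y z) := by
  have hs : Subsingleton S.ret.RetSet := (Nat.card_eq_one_iff_unique.1 h).1
  have h1 : S.ret.τ (Quotient.mk _ x) = S.ret.τ (Quotient.mk _ y) :=
    Quotient.exact (hs.elim (Quotient.mk S.ret.retSetoid (Quotient.mk S.retSetoid x))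
      (Quotient.mk S.ret.retSetoid (Quotient.mk S.retSetoid y)))
  exact Quotient.exact (congrFun (S.ret.τ_eq_iff.1 h1) (Quotient.mk _ z))

theorem σPerm_apply_iff {u v x y : X} :
    S.σPerm (S.σPerm u x) = S.σPerm (S.σPerm v y) ↔ S.σPerm x = S.σPerm y := by
  simp only [S.σPerm_eq_iff, S.σPerm_apply]
  refine ⟨fun hxy => S.σ_cancel (x := v) ((τ_σ_eq h v u x).trans hxy), fun hxy => ?_⟩
  exact (τ_σ_eq h u v x).trans (S.τ_σ_congr rfl hxy)

theorem σPerm_inv_apply_iff {u v x y : X} :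
    S.σPerm ((S.σPerm u)⁻¹ x) = S.σPerm ((S.σPerm v)⁻¹ y) ↔ S.σPerm x = S.σPerm y := by
  rw [← σPerm_apply_iff h (u := u) (v := v)]
  simp

theorem σPerm_zpow_apply_iff (e : X) (n : ℤ) {x y : X} :
    S.σPerm ((S.σPerm e ^ n) x) = S.σPerm ((S.σPerm e ^ n) y) ↔ S.σPerm x = S.σPerm y := by
  induction n with
  | zero => simp
  | succ n ih => rw [add_comm, zpow_add, zpow_one, Equiv.Perm.mul_apply, Equiv.Perm.mul_apply,
      σPerm_apply_iff h, ih]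
  | pred n ih => rw [sub_eq_add_neg, add_comm, zpow_add, zpow_neg_one, Equiv.Perm.mul_apply,
      Equiv.Perm.mul_apply, σPerm_inv_apply_iff h, ih]

/-- The braid relation gives σ_x σ_y = σ_{σ_x y} σ_{τ_y x}. In `Ret(X)` the class of σ_x y is that
of σ_u y, and σ_{σ_x y} maps τ_y x to `x`, so τ_y x has the class of σ_v⁻¹ x. -/
theorem σPerm_mul_σPerm (u v x y : X) :
    S.σPerm x * S.σPerm y = S.σPerm (S.σPerm u y) * S.σPerm ((S.σPerm v)⁻¹ x) := by
  have h1 : S.σPerm x * S.σPerm y = S.σPerm (S.σPerm x y) * S.σPerm (S.τ y x) :=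
    Equiv.ext fun z => S.braid₁ x y z
  rw [h1, (σPerm_apply_iff h (u := x) (v := u)).2 rfl]
  congr 1
  rw [← σPerm_apply_iff h (u := S.σ x y) (v := v)]
  simp [S.σ_σ_τ]

theorem conj_σPerm_div (e u x y : X) :
    S.σPerm u * (S.σPerm x * (S.σPerm y)⁻¹) * (S.σPerm u)⁻¹
      = S.σPerm (S.σPerm e x) * (S.σPerm (S.σPerm e y))⁻¹ := by
  have hx := σPerm_mul_σPerm h e e u x
  have hy := σPerm_mul_σPerm h e e u y
  rw [show S.σPerm u * (S.σPerm x * (S.σPerm y)⁻¹) * (S.σPerm u)⁻¹ =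
    (S.σPerm u * S.σPerm x) * (S.σPerm u * S.σPerm y)⁻¹ by group, hx, hy]
  group

theorem conj_zpow_σPerm_div (e : X) (n : ℤ) (x y : X) :
    S.σPerm e ^ n * (S.σPerm x * (S.σPerm y)⁻¹) * (S.σPerm e ^ n)⁻¹
      = S.σPerm ((S.σPerm e ^ n) x) * (S.σPerm ((S.σPerm e ^ n) y))⁻¹ := by
  induction n generalizing x y with
  | zero => simp
  | succ n ih =>
    rw [add_comm, zpow_add, zpow_one]
    simp only [Equiv.Perm.mul_apply]
    rw [← conj_σPerm_div h e e, ← ih]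
    group
  | pred n ih =>
    obtain ⟨x, rfl⟩ := (S.σPerm e).surjective x
    obtain ⟨y, rfl⟩ := (S.σPerm e).surjective y
    have hx : ∀ z, (S.σPerm e ^ (-(n : ℤ) - 1)) (S.σPerm e z) = (S.σPerm e ^ (-(n : ℤ))) z := by
      intro z
      rw [← Equiv.Perm.mul_apply, ← zpow_add_one]
      simp
    rw [hx, hx, ← ih, ← conj_σPerm_div h e e]
    group

theorem dis_commute {f g : Equiv.Perm X} (hf : f ∈ S.dis) (hg : g ∈ S.dis) : f * g = g * f := by
  have key : ∀ i j k l : X, (S.σPerm i * (S.σPerm j)⁻¹) * (S.σPerm k * (S.σPerm l)⁻¹) =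
      (S.σPerm k * (S.σPerm l)⁻¹) * (S.σPerm i * (S.σPerm j)⁻¹) := by
    -- With a prime denoting σ_i⁻¹, exchange gives σ_j⁻¹σ_k = σ_{k'}σ_{j'}⁻¹, σ_iσ_{k'} = σ_kσ_{i'}
    -- and σ_lσ_{j'} = σ_jσ_{l'}. The product thus becomes σ_k σ_{i'}σ_{l'}⁻¹ σ_j⁻¹, whose middle is
    -- σ_l⁻¹σ_i.
    intro i j k l
    have hjk : (S.σPerm j)⁻¹ * S.σPerm k =
        S.σPerm ((S.σPerm i)⁻¹ k) * (S.σPerm ((S.σPerm i)⁻¹ j))⁻¹ := by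
      rw [inv_mul_eq_iff_eq_mul, ← mul_assoc, eq_mul_inv_iff_mul_eq]
      simpa using σPerm_mul_σPerm h i i k ((S.σPerm i)⁻¹ j)
    have h1 := σPerm_mul_σPerm h i i i ((S.σPerm i)⁻¹ k)
    have h2 := σPerm_mul_σPerm h i i l ((S.σPerm i)⁻¹ j)
    have h3 := σPerm_mul_σPerm h i i i ((S.σPerm i)⁻¹ l)
    rw [← Equiv.Perm.mul_apply, mul_inv_cancel, Equiv.Perm.one_apply] at h1 h2 h3
    have hli : (S.σPerm l)⁻¹ * S.σPerm i =
        S.σPerm ((S.σPerm i)⁻¹ i) * (S.σPerm ((S.σPerm i)⁻¹ l))⁻¹ := by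
      rw [inv_mul_eq_iff_eq_mul, ← mul_assoc, eq_mul_inv_iff_mul_eq, h3]
    calc _ = S.σPerm i * ((S.σPerm j)⁻¹ * S.σPerm k) * (S.σPerm l)⁻¹ := by group
      _ = (S.σPerm i * S.σPerm ((S.σPerm i)⁻¹ k)) *
          (S.σPerm l * S.σPerm ((S.σPerm i)⁻¹ j))⁻¹ := by rw [hjk]; group
      _ = S.σPerm k * ((S.σPerm l)⁻¹ * S.σPerm i) * (S.σPerm j)⁻¹ := by
        rw [h1, h2, hli]; group
      _ = _ := by group
  have hc : S.dis ≤ Subgroup.centralizer (S.dis : Set (Equiv.Perm X)) := by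
    unfold dis
    rw [Subgroup.centralizer_closure, Subgroup.closure_le]
    rintro _ ⟨i, j, rfl⟩
    refine Subgroup.mem_centralizer_iff.2 ?_
    rintro _ ⟨k, l, rfl⟩
    exact key k l i j
  exact Subgroup.mem_centralizer_iff.1 (hc hg) f hf

theorem σPerm_dis_apply {g : Equiv.Perm X} (hg : g ∈ S.dis) (x : X) :
    S.σPerm (g x) = S.σPerm x := by
  induction hg using Subgroup.closure_induction generalizing x with
  | mem g hg =>
    obtain ⟨u, v, rfl⟩ := hg
    obtain ⟨x, rfl⟩ := (S.σPerm v).surjective x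
    rw [Equiv.Perm.mul_apply, ← Equiv.Perm.mul_apply (S.σPerm v)⁻¹, inv_mul_cancel]
    exact (σPerm_apply_iff h).2 rfl
  | one => rfl
  | mul f g _ _ hf hg => rw [Equiv.Perm.mul_apply, hf, hg]
  | inv g _ hg => simpa using (hg (g⁻¹ x)).symm

theorem conj_zpow_mem_dis (e : X) (n : ℤ) {g : Equiv.Perm X} (hg : g ∈ S.dis) :
    S.σPerm e ^ n * g * (S.σPerm e ^ n)⁻¹ ∈ S.dis := by
  induction hg using Subgroup.closure_induction with
  | mem g hg =>
    obtain ⟨u, v, rfl⟩ := hg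
    rw [conj_zpow_σPerm_div h]
    exact Subgroup.subset_closure ⟨_, _, rfl⟩
  | one => simp [S.dis.one_mem]
  | mul f g _ _ hf hg => simpa [mul_assoc] using S.dis.mul_mem hf hg
  | inv g _ hg => simpa [mul_assoc] using S.dis.inv_mem hg

end LevelTwo

/-! ### Degrees of permutations modulo displacements. -/

/-- `g` acts on the retraction as the `n`-th power of `σ e`. -/
def HasDegree (e : X) (g : Equiv.Perm X) (n : ℤ) : Prop := g * (S.σPerm e ^ n)⁻¹ ∈ S.dis

variable {S}

theorem hasDegree_zpow (e : X) (n : ℤ) : S.HasDegree e (S.σPerm e ^ n) n := by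
  simp [HasDegree, S.dis.one_mem]

theorem hasDegree_of_mem_dis (e : X) {g : Equiv.Perm X} (hg : g ∈ S.dis) : S.HasDegree e g 0 := by
  simpa [HasDegree] using hg

theorem HasDegree.mem_dis {e : X} {g : Equiv.Perm X} (hg : S.HasDegree e g 0) : g ∈ S.dis := by
  simpa [HasDegree] using hg

theorem hasDegree_σPerm (e x : X) : S.HasDegree e (S.σPerm x) 1 :=
  Subgroup.subset_closure ⟨x, e, by simp⟩

section LevelTwo

variable (h : S.ret.IsPermutational) {e : X}
include h

theorem HasDegree.mul {f g : Equiv.Perm X} {n k : ℤ} (hf : S.HasDegree e f n)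
    (hg : S.HasDegree e g k) : S.HasDegree e (f * g) (n + k) := by
  have := S.dis.mul_mem hf (conj_zpow_mem_dis h e n hg)
  rw [HasDegree, zpow_add]
  convert this using 1
  group

theorem HasDegree.inv {g : Equiv.Perm X} {n : ℤ} (hg : S.HasDegree e g n) :
    S.HasDegree e g⁻¹ (-n) := by
  have := conj_zpow_mem_dis h e (-n) (S.dis.inv_mem hg)
  rw [HasDegree]
  convert this using 1
  group

/-- Generators have degree 1 and degrees add. The degree is not unique when a nontrivial power of `σ
e` is a displacement, so it is a relation and not a function. -/
theorem exists_hasDegree {g : Equiv.Perm X} (hg : g ∈ S.permGroup) :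
    ∃ n, S.HasDegree e g n := by
  induction hg using Subgroup.closure_induction with
  | mem g hg => obtain ⟨x, rfl⟩ := hg; exact ⟨1, hasDegree_σPerm e x⟩
  | one => exact ⟨0, by simp [HasDegree, S.dis.one_mem]⟩
  | mul f g _ _ hf hg =>
    obtain ⟨n, hn⟩ := hf
    obtain ⟨k, hk⟩ := hg
    exact ⟨_, hn.mul h hk⟩
  | inv g _ hg => obtain ⟨n, hn⟩ := hg; exact ⟨_, hn.inv h⟩

/-- The displacement factor of `g` drops out because `Dis(X)` is abelian. -/
theorem HasDegree.conj {g δ : Equiv.Perm X} {n : ℤ} (hg : S.HasDegree e g n) (hδ : δ ∈ S.dis) :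
    g * δ * g⁻¹ = S.σPerm e ^ n * δ * (S.σPerm e ^ n)⁻¹ := by
  have := dis_commute h hg (conj_zpow_mem_dis h e n hδ)
  calc g * δ * g⁻¹ = g * (S.σPerm e ^ n)⁻¹ *
        (S.σPerm e ^ n * δ * (S.σPerm e ^ n)⁻¹) * (g * (S.σPerm e ^ n)⁻¹)⁻¹ := by group
    _ = _ := by rw [this]; group

theorem HasDegree.σPerm_apply {g : Equiv.Perm X} {n : ℤ} (hg : S.HasDegree e g n) (x : X) :
    S.σPerm (g x) = S.σPerm ((S.σPerm e ^ n) x) := by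
  rw [← σPerm_dis_apply h hg ((S.σPerm e ^ n) x)]
  simp

end LevelTwo

theorem dis_le_permGroup : S.dis ≤ S.permGroup := by
  rw [dis, Subgroup.closure_le]
  rintro _ ⟨x, y, rfl⟩
  exact S.permGroup.mul_mem (Subgroup.subset_closure ⟨x, rfl⟩)
    (S.permGroup.inv_mem (Subgroup.subset_closure ⟨y, rfl⟩))

end Solution
end YB

/-! ### The models on `B × ZMod m` and their invariants. -/

namespace YB
namespace Solution

section Model

variable {B : Type u} [AddCommGroup B] {m : ℕ} (d : ZMod m → B) (c : B)

/-- The cocycle on `ZMod m` that is `c` at `-1` and zero elsewhere. -/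
def wrap (j : ZMod m) : B := if j = -1 then c else 0

/-- The permutation of `B × ZMod m` by which the elements of second component `i` act. -/
def modelPerm (i : ZMod m) : Equiv.Perm (B × ZMod m) where
  toFun x := (x.1 + d (i - x.2) + wrap c x.2, x.2 + 1)
  invFun x := (x.1 - d (i - (x.2 - 1)) - wrap c (x.2 - 1), x.2 - 1)
  left_inv x := by
    ext
    · simp only [add_sub_cancel_right]
      abel
    · simp
  right_inv x := by
    ext
    · simp only
      abel
    · simp

/-- The translation depends on `i` only through `i - x.2`, and each step raises `x.2` by one, so the
two contributions of `d` merely change order. This is the content of the braid relation for the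
model. -/
theorem modelPerm_mul (i j : ZMod m) :
    modelPerm d c i * modelPerm d c j = modelPerm d c (j + 1) * modelPerm d c (i - 1) := by
  ext x
  · simp only [modelPerm, Equiv.Perm.mul_apply, Equiv.coe_fn_mk]
    rw [show i - (x.2 + 1) = i - 1 - x.2 by ring, show j + 1 - (x.2 + 1) = j - x.2 by ring]
    abel
  · rfl

/-- The solution on `B × ZMod m` given by `d : ZMod m → B` and `c : B`. -/
def model : Solution (B × ZMod m) where
  σ x := modelPerm d c x.2
  -- Forced by σ_{σ_x y}(τ_y x) = x, as σ_x y has second component `y.2 + 1`.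
  τ y := fun x => (modelPerm d c (y.2 + 1)).symm x
  bij_σ x := (modelPerm d c x.2).bijective
  bij_τ y := (modelPerm d c (y.2 + 1)).symm.bijective
  invol x y := by
    ext1
    · exact (modelPerm d c (y.2 + 1)).apply_symm_apply x
    · have : ((modelPerm d c (y.2 + 1)).symm x).2 + 1 = x.2 := sub_add_cancel _ _
      exact (congrArg (fun i => (modelPerm d c i).symm (modelPerm d c x.2 y)) this).trans
        ((modelPerm d c x.2).symm_apply_apply y)
  braid₁ x y z := congrArg (fun g : Equiv.Perm (B × ZMod m) => g z) (modelPerm_mul d c x.2 y.2)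
  braid₂ x y z := by
    ext
    · simp only [modelPerm, Equiv.coe_fn_mk, Equiv.coe_fn_symm_mk]
      ring_nf
      abel
    · simp [modelPerm]
  braid₃ x y z := by
    ext
    · simp only [modelPerm, Equiv.coe_fn_mk, Equiv.coe_fn_symm_mk]
      ring_nf
      abel
    · simp [modelPerm]

theorem model_σPerm (x : B × ZMod m) : (model d c).σPerm x = modelPerm d c x.2 :=
  Equiv.ext fun _ => rfl

theorem modelPerm_apply (i : ZMod m) (x : B × ZMod m) :
    modelPerm d c i x = (x.1 + d (i - x.2) + wrap c x.2, x.2 + 1) := rfl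

variable {d c}

theorem permGroup_model_snd {g : Equiv.Perm (B × ZMod m)} (hg : g ∈ (model d c).permGroup)
    (x : B × ZMod m) : (g x).2 = x.2 + (g 0).2 := by
  induction hg using Subgroup.closure_induction generalizing x with
  | mem g hg => obtain ⟨y, rfl⟩ := hg; simp [-σPerm_apply, model_σPerm, modelPerm_apply]
  | one => simp
  | mul f g _ _ hf hg =>
    rw [Equiv.Perm.mul_apply, Equiv.Perm.mul_apply, hf, hg, hf (g 0)]
    ring
  | inv g _ hg =>
    have h1 := hg (g⁻¹ x)
    have h2 := hg (g⁻¹ 0)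
    rw [← Equiv.Perm.mul_apply, mul_inv_cancel, Equiv.Perm.one_apply] at h1 h2
    rw [h1, add_assoc, add_comm _ (g⁻¹ 0).2, ← h2]
    simp

/-- The shift of the second component, as a homomorphism. -/
def modelDegree : (model d c).permGroup →* Multiplicative (ZMod m) where
  toFun g := Multiplicative.ofAdd ((g : Equiv.Perm (B × ZMod m)) 0).2
  map_one' := rfl
  map_mul' f g := by
    rw [← ofAdd_add, add_comm, ← permGroup_model_snd f.2]
    rfl

/-- The shifts and the `wrap` terms cancel in σ_y σ_z⁻¹, leaving a translation on each fibre. -/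
theorem dis_model_apply {g : Equiv.Perm (B × ZMod m)} (hg : g ∈ (model d c).dis) :
    ∃ f : ZMod m → B, ∀ x, g x = (x.1 + f x.2, x.2) := by
  induction hg using Subgroup.closure_induction with
  | mem g hg =>
    obtain ⟨y, z, rfl⟩ := hg
    refine ⟨fun j => d (y.2 - (j - 1)) - d (z.2 - (j - 1)), fun x => ?_⟩
    obtain ⟨x, rfl⟩ := ((model d c).σPerm z).surjective x
    rw [Equiv.Perm.mul_apply, ← Equiv.Perm.mul_apply ((model d c).σPerm z)⁻¹, inv_mul_cancel]
    simp only [Equiv.Perm.one_apply, model_σPerm, modelPerm_apply, add_sub_cancel_right]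
    ext
    · simp only
      abel
    · rfl
  | one => exact ⟨0, fun x => by simp⟩
  | mul f g _ _ hf hg =>
    obtain ⟨f', hf⟩ := hf
    obtain ⟨g', hg⟩ := hg
    exact ⟨g' + f', fun x => by simp [hf, hg, add_assoc]⟩
  | inv g _ hg =>
    obtain ⟨g', hg⟩ := hg
    refine ⟨-g', fun x => ?_⟩
    rw [Equiv.Perm.inv_eq_iff_eq, hg]
    simp

theorem exists_dis_model (h0 : d 0 = 0) (hd : AddSubgroup.closure (Set.range d) = ⊤) (w : B) :
    ∃ g ∈ (model d c).dis, ∀ a, g (a, 0) = (a + w, 0) := by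
  have hw : w ∈ AddSubgroup.closure (Set.range d) := hd ▸ AddSubgroup.mem_top w
  induction hw using AddSubgroup.closure_induction with
  | mem w hw =>
    obtain ⟨i, rfl⟩ := hw
    -- From `(a, 0)` the inverse of σ_(0,-1) leads to `(a - c, -1)`; σ_(0,i-1) then adds `d (i - 1 -
    -- (-1)) = d i` and restores `c`.
    refine ⟨_, Subgroup.subset_closure ⟨(0, i - 1), (0, -1), rfl⟩, fun a => ?_⟩
    have h1 : ((a, 0) : B × ZMod m) = modelPerm d c (-1) (a - c, -1) := by
      simp [modelPerm_apply, h0, wrap]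
    rw [model_σPerm, model_σPerm, Equiv.Perm.mul_apply, h1, ← Equiv.Perm.mul_apply (modelPerm _ _ _)⁻¹,
      inv_mul_cancel]
    simp [modelPerm_apply, wrap]
    abel
  | zero => exact ⟨1, Subgroup.one_mem _, fun a => by simp⟩
  | add x y _ _ hx hy =>
    obtain ⟨f, hf, hf'⟩ := hx
    obtain ⟨g, hg, hg'⟩ := hy
    exact ⟨g * f, Subgroup.mul_mem _ hg hf, fun a => by simp [hf', hg', add_assoc]⟩
  | neg x _ hx =>
    obtain ⟨f, hf, hf'⟩ := hx
    exact ⟨f⁻¹, Subgroup.inv_mem _ hf, fun a => by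
      rw [Equiv.Perm.inv_eq_iff_eq, hf']
      simp⟩

theorem modelDegree_surjective [NeZero m] :
    Function.Surjective (modelDegree (d := d) (c := c)) := by
  intro j
  let g : (model d c).permGroup := ⟨(model d c).σPerm 0, Subgroup.subset_closure ⟨0, rfl⟩⟩
  refine ⟨g ^ (Multiplicative.toAdd j).val, ?_⟩
  have hg : modelDegree g = Multiplicative.ofAdd 1 := by
    change Multiplicative.ofAdd ((0 : ZMod m) + 1) = _
    rw [zero_add]
  rw [map_pow, hg, ← ofAdd_nsmul]
  simp

theorem model_isIndecomposable [NeZero m] (h0 : d 0 = 0)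
    (hd : AddSubgroup.closure (Set.range d) = ⊤) : (model d c).IsIndecomposable := by
  have key : ∀ x : B × ZMod m, ∃ g : (model d c).permGroup, g • (0 : B × ZMod m) = x := by
    intro x
    obtain ⟨g, hg⟩ := modelDegree_surjective (d := d) (c := c) (Multiplicative.ofAdd x.2)
    replace hg : ((g : Equiv.Perm (B × ZMod m)) 0).2 = x.2 := hg
    have h1 := permGroup_model_snd g.2 (g⁻¹ • x)
    change ((g • g⁻¹ • x)).2 = _ at h1
    rw [smul_inv_smul, hg, right_eq_add] at h1
    obtain ⟨f, hf, hf'⟩ := exists_dis_model (c := c) h0 hd (g⁻¹ • x).1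
    refine ⟨g * ⟨f, dis_le_permGroup hf⟩, ?_⟩
    rw [mul_smul, ← eq_inv_smul_iff]
    refine (hf' 0).trans ?_
    ext <;> simp [h1]
  refine ⟨fun x y => ?_⟩
  obtain ⟨f, rfl⟩ := key x
  obtain ⟨g, rfl⟩ := key y
  exact ⟨g * f⁻¹, by simp [mul_smul]⟩

theorem model_isLevelTwo [Nontrivial B] (h0 : d 0 = 0)
    (hd : AddSubgroup.closure (Set.range d) = ⊤) : (model d c).IsLevelTwo := by
  constructor
  · intro h
    have hs : Subsingleton (model d c).RetSet := (Nat.card_eq_one_iff_unique.1 h).1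
    have hd0 : ∀ i, d i = 0 := fun i => by
      have h1 : (model d c).τ (0, i) = (model d c).τ (0, 0) :=
        Quotient.exact (hs.elim (Quotient.mk (model d c).retSetoid (0, i))
          (Quotient.mk (model d c).retSetoid (0, 0)))
      have h2 := congrArg Prod.fst (congrFun ((model d c).τ_eq_iff.1 h1) (0, 0))
      change (0 : B) + d (i - 0) + wrap c 0 = 0 + d (0 - 0) + wrap c 0 at h2
      simpa [h0] using h2
    have : (⊤ : AddSubgroup B) = ⊥ := by
      rw [← hd, AddSubgroup.closure_eq_bot_iff]
      rintro _ ⟨i, rfl⟩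
      exact hd0 i
    exact top_ne_bot this
  · refine Nat.card_eq_one_iff_unique.2 ⟨⟨?_⟩, ⟨Quotient.mk _ (Quotient.mk _ (0, 0))⟩⟩
    rintro ⟨⟨x⟩⟩ ⟨⟨y⟩⟩
    refine Quotient.sound ?_
    refine (model d c).ret.τ_eq_iff.2 (funext fun z => ?_)
    obtain ⟨z⟩ := z
    -- The second component of σ_x z is `z.2 + 1` for every `x`, and `τ` sees only that component of
    -- its index.
    exact Quotient.sound rfl

theorem model_index_stabDis [NeZero m] (h0 : d 0 = 0)
    (hd : AddSubgroup.closure (Set.range d) = ⊤) : ((model d c).stabDis 0).index = m := by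
  have hker : (model d c).stabDis 0 = (modelDegree (d := d) (c := c)).ker := by
    apply le_antisymm
    · refine sup_le (fun g hg => ?_) (fun g hg => ?_)
      · have hg' : (g : Equiv.Perm (B × ZMod m)) 0 = 0 := hg
        exact congrArg Prod.snd hg'
      · obtain ⟨f, hf⟩ := dis_model_apply (Subgroup.mem_subgroupOf.1 hg)
        exact congrArg Prod.snd (hf 0)
    · intro g hg
      replace hg : ((g : Equiv.Perm (B × ZMod m)) 0).2 = 0 := hg
      obtain ⟨f, hf, hf'⟩ := exists_dis_model (c := c) h0 hd ((g : Equiv.Perm (B × ZMod m)) 0).1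
      let f₁ : (model d c).permGroup := ⟨f, dis_le_permGroup hf⟩
      have hf₁ : f₁ ∈ (model d c).stabDis 0 :=
        Subgroup.mem_sup_right (Subgroup.mem_subgroupOf.2 hf)
      have h1 : f₁⁻¹ * g ∈ (model d c).stabDis 0 := by
        refine Subgroup.mem_sup_left ?_
        rw [MulAction.mem_stabilizer_iff, mul_smul, inv_smul_eq_iff]
        refine Eq.trans ?_ (hf' 0).symm
        ext
        · simp [Subgroup.smul_def]
        · exact hg
      simpa using mul_mem hf₁ h1
  rw [hker, Subgroup.index_ker, MonoidHom.range_eq_top.2 modelDegree_surjective]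
  simp

theorem model_disQuotientIso {A : Type v} [AddCommGroup A] (φ : A ≃+ B) (h0 : d 0 = 0)
    (hd : AddSubgroup.closure (Set.range d) = ⊤) : (model d c).DisQuotientIso 0 A := by
  -- The translation a displacement induces on the fibre over 0; its kernel is the stabilizer of the
  -- base point.
  let ψ : (model d c).dis →* Multiplicative B :=
    { toFun := fun g => Multiplicative.ofAdd ((g : Equiv.Perm (B × ZMod m)) 0).1
      map_one' := rfl
      map_mul' := fun f g => by
        obtain ⟨f', hf⟩ := dis_model_apply f.2
        obtain ⟨g', hg⟩ := dis_model_apply g.2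
        rw [← ofAdd_add]
        simp [hf, hg, add_comm] }
  have hψ : Function.Surjective ψ := fun w => by
    obtain ⟨f, hf, hf'⟩ := exists_dis_model (c := c) h0 hd (Multiplicative.toAdd w)
    refine ⟨⟨f, hf⟩, ?_⟩
    change Multiplicative.ofAdd (f (0, 0)).1 = w
    rw [hf']
    simp
  have hker : MulAction.stabilizer (model d c).dis (0 : B × ZMod m) = ψ.ker := by
    ext g
    obtain ⟨f', hf⟩ := dis_model_apply g.2
    have h1 : g • (0 : B × ZMod m) = (g : Equiv.Perm (B × ZMod m)) 0 := rfl
    have h2 : ψ g = Multiplicative.ofAdd ((g : Equiv.Perm (B × ZMod m)) 0).1 := rfl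
    rw [MulAction.mem_stabilizer_iff, MonoidHom.mem_ker, h1, h2, hf]
    simp [Prod.ext_iff]
  rw [DisQuotientIso, hker]
  exact ⟨inferInstance, ⟨(QuotientGroup.quotientKerEquivOfSurjective ψ hψ).trans
    φ.symm.toMultiplicative⟩⟩

end Model
end Solution
end YB

/-! ### Isomorphisms between models. -/

namespace YB
namespace Solution

section ModelIso

variable {B : Type u} [AddCommGroup B] {m : ℕ} {d d' : ZMod m → B} {c c' : B}

theorem model_isIso (φ : B ≃+ B) (hd : ∀ i, φ (d i) = d' i) (hc : φ c = c') :
    (model d c).IsIso (model d' c') := by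
  refine ⟨φ.toEquiv.prodCongr (Equiv.refl _), fun x y => ?_⟩
  change (φ (y.1 + d (x.2 - y.2) + wrap c y.2), y.2 + 1) =
    (φ y.1 + d' (x.2 - y.2) + wrap c' y.2, y.2 + 1)
  rw [map_add, map_add, hd]
  simp [wrap, apply_ite φ, hc]

theorem sum_wrap [NeZero m] (c : B) (j₀ : ZMod m) : ∑ j, wrap c (j₀ + j) = c := by
  simp only [wrap, ← eq_sub_iff_add_eq']
  simp

/-- An isomorphism respects displacements, so it carries translation by `d u` to translation by `d'
u`; as `d` and `d'` generate, this yields an automorphism. The total translation around the cycle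
then recovers `c`. -/
theorem exists_addEquiv_of_model_isIso [NeZero m] [Finite B] (h0 : d 0 = 0) (h0' : d' 0 = 0)
    (hd : AddSubgroup.closure (Set.range d) = ⊤) (hd' : AddSubgroup.closure (Set.range d') = ⊤)
    (h : (model d c).IsIso (model d' c')) :
    ∃ φ : B ≃+ B, (∀ i, φ (d i) = d' i) ∧ φ c = c' := by
  obtain ⟨Φ, hΦ⟩ := h
  have hΦ₁ : ∀ (x : B × ZMod m) (y : B × ZMod m),
      Φ (y.1 + d (x.2 - y.2) + wrap c y.2, y.2 + 1) =
      ((Φ y).1 + d' ((Φ x).2 - (Φ y).2) + wrap c' (Φ y).2, (Φ y).2 + 1) := hΦ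
  -- translating by `d u` does not change the second component
  have hg : ∀ (w a : B) (j : ZMod m), (Φ (a + w, j)).2 = (Φ (a, j)).2 := by
    intro w
    have hw : w ∈ AddSubgroup.closure (Set.range d) := hd ▸ AddSubgroup.mem_top w
    induction hw using AddSubgroup.closure_induction with
    | mem w hw =>
      obtain ⟨u, rfl⟩ := hw
      intro a j
      -- The point is chosen so that the two actions send it to `(a + d u, j)` and `(a, j)`.
      have h1 := congrArg Prod.snd (hΦ₁ (0, u + (j - 1)) (a - wrap c (j - 1), j - 1))
      have h2 := congrArg Prod.snd (hΦ₁ (0, j - 1) (a - wrap c (j - 1), j - 1))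
      simp only [sub_self, h0, add_sub_cancel_right, sub_add_cancel, add_zero] at h1 h2
      rw [sub_add_eq_add_sub, sub_add_cancel] at h1
      rw [h1, h2]
    | zero => simp
    | add x y _ _ hx hy => intro a j; rw [← add_assoc, hy, hx]
    | neg x _ hx => intro a j; rw [← hx (a + -x), neg_add_cancel_right]
  obtain ⟨j₀, hj₀⟩ : ∃ j₀, j₀ = (Φ 0).2 := ⟨_, rfl⟩
  have hg0 : ∀ a j, (Φ (a, j)).2 = (Φ (0, j)).2 := fun a j => by simpa using hg a 0 j
  have hg1 : ∀ j, (Φ (0, j + 1)).2 = (Φ (0, j)).2 + 1 := fun j => by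
    have h1 := congrArg Prod.snd (hΦ₁ 0 (0, j))
    simp only at h1
    rwa [hg0] at h1
  have hg2 : ∀ a j, (Φ (a, j)).2 = j₀ + j := by
    have : ∀ n : ℕ, (Φ (0, (n : ZMod m))).2 = j₀ + n := by
      intro n
      induction n with
      | zero => simp [hj₀]; rfl
      | succ n ih => push_cast; rw [hg1, ih]; ring
    intro a j
    rw [hg0]
    simpa using this j.val
  have hf : ∀ u a j, (Φ (a + d u, j)).1 = (Φ (a, j)).1 + d' u := by
    intro u a j
    have h1 := congrArg Prod.fst (hΦ₁ (0, u + (j - 1)) (a - wrap c (j - 1), j - 1))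
    have h2 := congrArg Prod.fst (hΦ₁ (0, j - 1) (a - wrap c (j - 1), j - 1))
    simp only [sub_self, h0, h0', hg2, add_sub_cancel_right, sub_add_cancel, add_zero,
      add_sub_add_left_eq_sub] at h1 h2
    rw [sub_add_eq_add_sub, sub_add_cancel] at h1
    rw [h1, h2]
    abel
  have hφ : ∀ w, ∃ w', ∀ a j, (Φ (a + w, j)).1 = (Φ (a, j)).1 + w' := by
    intro w
    have hw : w ∈ AddSubgroup.closure (Set.range d) := hd ▸ AddSubgroup.mem_top w
    induction hw using AddSubgroup.closure_induction with
    | mem w hw => obtain ⟨u, rfl⟩ := hw; exact ⟨d' u, hf u⟩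
    | zero => exact ⟨0, by simp⟩
    | add x y _ _ hx hy =>
      obtain ⟨x', hx⟩ := hx
      obtain ⟨y', hy⟩ := hy
      exact ⟨x' + y', fun a j => by rw [← add_assoc, hy, hx, add_assoc]⟩
    | neg x _ hx =>
      obtain ⟨x', hx⟩ := hx
      exact ⟨-x', fun a j => by rw [eq_add_neg_iff_add_eq, ← hx, neg_add_cancel_right]⟩
  choose φ hφ using hφ
  have hadd : ∀ x y, φ (x + y) = φ x + φ y := fun x y => by
    have h1 := hφ (x + y) 0 0
    rw [← add_assoc, hφ y, hφ x, add_assoc] at h1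
    exact (add_left_cancel h1).symm
  have hφd : ∀ i, φ (d i) = d' i := fun i =>
    add_left_cancel ((hφ (d i) 0 0).symm.trans (hf i 0 0))
  let φ' : B →+ B := AddMonoidHom.mk' φ hadd
  have hsurj : Function.Surjective φ' := by
    rw [← AddMonoidHom.range_eq_top, eq_top_iff, ← hd', AddSubgroup.closure_le]
    rintro _ ⟨i, rfl⟩
    exact ⟨d i, hφd i⟩
  refine ⟨AddEquiv.ofBijective φ' ⟨Finite.injective_iff_surjective.2 hsurj, hsurj⟩, hφd, ?_⟩
  change φ' c = c'
  have hstep : ∀ j, φ' (wrap c j) + (Φ (0, j + 1)).1 = (Φ (0, j)).1 + wrap c' (j₀ + j) := by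
    intro j
    have h1 := congrArg Prod.fst (hΦ₁ (0, j) (0, j))
    simp only [sub_self, h0, h0', hg2, add_zero, hφ] at h1
    rw [← h1, add_comm]
    rfl
  -- Summed over the whole cycle, the first components of `Φ` telescope, and each `wrap` contributes
  -- exactly once wherever the cycle starts.
  have hsum := Finset.sum_congr rfl fun j (_ : j ∈ Finset.univ) => hstep j
  rw [Finset.sum_add_distrib, Finset.sum_add_distrib, sum_wrap, ← map_sum,
    Fintype.sum_equiv (Equiv.addRight (1 : ZMod m)) (fun j => (Φ (0, j + 1)).1)
      (fun j => (Φ (0, j)).1) (fun _ => rfl), add_comm] at hsum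
  rw [← add_left_cancel hsum]
  simpa using congrArg φ' (sum_wrap c (0 : ZMod m)).symm

end ModelIso
end Solution
end YB

/-! ### The index `m` as the length of the cycle of displacement orbits. -/

namespace YB
namespace Solution

section Coordinates

variable {X : Type u} {S : Solution X} (h : S.ret.IsPermutational) {e : X}
include h

theorem HasDegree.conj_mem_dis {g δ : Equiv.Perm X} {n : ℤ} (hg : S.HasDegree e g n)
    (hδ : δ ∈ S.dis) : g * δ * g⁻¹ ∈ S.dis := by
  rw [hg.conj h hδ]
  exact conj_zpow_mem_dis h e n hδ

/-- `Dis(X)` is normal, so elements of the join are products `f * δ` with `f` fixing `e`, and then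
`f * δ` and the displacement `f * δ * f⁻¹` agree at `e`. -/
theorem stabDis_apply_mem {g : S.permGroup} :
    g ∈ S.stabDis e ↔ ∃ δ ∈ S.dis, (g : Equiv.Perm X) e = δ e := by
  constructor
  · intro hg
    have hn : (S.dis.subgroupOf S.permGroup).Normal := by
      refine ⟨fun f hf g => ?_⟩
      rw [Subgroup.mem_subgroupOf] at hf ⊢
      obtain ⟨n, hn⟩ := exists_hasDegree h (e := e) g.2
      exact hn.conj_mem_dis h hf
    obtain ⟨f, hf, δ, hδ, rfl⟩ := Subgroup.mem_sup_of_normal_right.1 hg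
    rw [MulAction.mem_stabilizer_iff] at hf
    replace hf : (f : Equiv.Perm X) e = e := hf
    obtain ⟨n, hn⟩ := exists_hasDegree h (e := e) f.2
    refine ⟨f * δ * (f : Equiv.Perm X)⁻¹, hn.conj_mem_dis h hδ, ?_⟩
    rw [Equiv.Perm.mul_apply, Equiv.Perm.inv_eq_iff_eq.2 hf.symm]
    rfl
  · rintro ⟨δ, hδ, hg⟩
    let δ' : S.permGroup := ⟨δ, dis_le_permGroup hδ⟩
    have h1 : δ'⁻¹ * g ∈ MulAction.stabilizer S.permGroup e := by
      rw [MulAction.mem_stabilizer_iff, mul_smul, inv_smul_eq_iff]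
      exact hg
    have h2 : δ' ∈ S.stabDis e := Subgroup.mem_sup_right (Subgroup.mem_subgroupOf.2 hδ)
    simpa using mul_mem h2 (Subgroup.mem_sup_left h1 : _ ∈ S.stabDis e)

/-- `𝒢(X)` is generated by `σ e` modulo `Dis(X)`, so pulling `𝒢(X)_e Dis(X)` back along the powers
of `σ e` gives a subgroup of ℤ of the same index `m`, that is, `mℤ`. -/
theorem zpow_apply_iff_dvd {m : ℕ} (hm : (S.stabDis e).index = m) (n : ℤ) :
    (∃ δ ∈ S.dis, (S.σPerm e ^ n) e = δ e) ↔ (m : ℤ) ∣ n := by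
  let s : S.permGroup := ⟨S.σPerm e, Subgroup.subset_closure ⟨e, rfl⟩⟩
  have hdec : ∀ g : S.permGroup, ∃ n : ℤ, g * (s ^ n)⁻¹ ∈ S.dis.subgroupOf S.permGroup := by
    intro g
    obtain ⟨n, hn⟩ := exists_hasDegree h (e := e) g.2
    exact ⟨n, hn⟩
  have hcomm : ∀ f g : S.permGroup, f * g * f⁻¹ * g⁻¹ ∈ S.dis.subgroupOf S.permGroup := by
    intro f g
    obtain ⟨n, hn⟩ := exists_hasDegree h (e := e) f.2
    obtain ⟨k, hk⟩ := exists_hasDegree h (e := e) g.2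
    have := (((hn.mul h hk).mul h (hn.inv h)).mul h (hk.inv h))
    rw [show n + k + -n + -k = 0 by ring] at this
    exact this.mem_dis
  have hle : S.dis.subgroupOf S.permGroup ≤ S.stabDis e := le_sup_right
  have hnormal : (S.stabDis e).Normal := by
    refine ⟨fun f hf g => ?_⟩
    have := mul_mem (hle (hcomm g f)) hf
    simpa using this
  let K : AddSubgroup ℤ := (S.stabDis e).comap (zpowersHom S.permGroup s) |>.toAddSubgroup
  have hK : K.index = m := by
    change ((S.stabDis e).comap (zpowersHom S.permGroup s)).index = m
    rw [Subgroup.index_comap, ← Subgroup.relIndex_sup_right, ← hm,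
      ← Subgroup.relIndex_top_right]
    congr 1
    rw [eq_top_iff]
    intro g _
    obtain ⟨n, hn⟩ := hdec g
    have := mul_mem (Subgroup.mem_sup_right (hle hn) :
      _ ∈ (zpowersHom S.permGroup s).range ⊔ S.stabDis e)
      (Subgroup.mem_sup_left ⟨Multiplicative.ofAdd n, rfl⟩)
    simpa using this
  have hmem : n ∈ K ↔ (m : ℤ) ∣ n := by
    obtain ⟨a, ha⟩ := Int.subgroup_cyclic K
    rw [← AddSubgroup.zmultiples_eq_closure] at ha
    rw [ha, Int.index_zmultiples] at hK
    rw [ha, Int.mem_zmultiples_iff, ← hK, Int.natAbs_dvd]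
  rw [← hmem]
  exact (stabDis_apply_mem h (g := s ^ n)).symm

theorem HasDegree.apply_iff_dvd {m : ℕ} (hm : (S.stabDis e).index = m) {g : Equiv.Perm X} {n : ℤ}
    (hg : S.HasDegree e g n) : (∃ δ ∈ S.dis, g e = δ e) ↔ (m : ℤ) ∣ n := by
  rw [← zpow_apply_iff_dvd h hm]
  constructor
  · rintro ⟨δ, hδ, hgδ⟩
    refine ⟨_, mul_mem (inv_mem hg) hδ, ?_⟩
    rw [Equiv.Perm.mul_apply, ← hgδ, ← Equiv.Perm.mul_apply]
    simp
  · rintro ⟨δ, hδ, hgδ⟩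
    refine ⟨_, mul_mem hg hδ, ?_⟩
    rw [Equiv.Perm.mul_apply, ← hgδ, ← Equiv.Perm.mul_apply]
    simp

end Coordinates
end Solution
end YB

/-! ### Coordinates: every solution in question is isomorphic to a model. -/

namespace YB
namespace Solution

section Existence

variable {X : Type u} {S : Solution X} (h : S.ret.IsPermutational) {e : X}

/-- The class of `σ` in position `n` of the cycle of `Ret(X)`. -/
noncomputable def cycle (S : Solution X) (e : X) (n : ℤ) : Equiv.Perm X :=
  S.σPerm ((S.σPerm e ^ n) e)

/-- The product of the first `t` permutations of the cycle. -/
noncomputable def path (S : Solution X) (e : X) : ℕ → Equiv.Perm X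
  | 0 => 1
  | t + 1 => S.cycle e t * S.path e t

/-- Quotients of permutations of the cycle, as displacements. -/
noncomputable def cycleDiv (S : Solution X) (e : X) (n k : ℤ) : S.dis :=
  ⟨S.cycle e n * (S.cycle e k)⁻¹, Subgroup.subset_closure ⟨_, _, rfl⟩⟩

include h

theorem HasDegree.σPerm_apply_base {g : Equiv.Perm X} {n : ℤ} (hg : S.HasDegree e g n) :
    S.σPerm (g e) = S.cycle e n := hg.σPerm_apply h e

theorem path_hasDegree (t : ℕ) : S.HasDegree e (S.path e t) t := by
  induction t with
  | zero => simp [path, HasDegree, S.dis.one_mem]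
  | succ t ih =>
    have := (hasDegree_σPerm e ((S.σPerm e ^ (t : ℤ)) e)).mul h ih
    rw [add_comm (1 : ℤ)] at this
    exact_mod_cast this

theorem cycle_periodic {m : ℕ} (hm : (S.stabDis e).index = m) {n k : ℤ} (hnk : (m : ℤ) ∣ n - k) :
    S.cycle e n = S.cycle e k := by
  obtain ⟨δ, hδ, hn⟩ := (zpow_apply_iff_dvd h hm _).2 hnk
  rw [cycle, show n = k + (n - k) by ring, zpow_add, Equiv.Perm.mul_apply, hn, cycle,
    σPerm_zpow_apply_iff h]
  exact σPerm_dis_apply h hδ e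

theorem conj_cycleDiv {g : Equiv.Perm X} {r : ℤ} (hg : S.HasDegree e g r) (n k : ℤ) :
    g * (S.cycleDiv e n k) * g⁻¹ = S.cycleDiv e (r + n) (r + k) := by
  rw [hg.conj h (S.cycleDiv e n k).2]
  simp only [cycleDiv, cycle]
  rw [conj_zpow_σPerm_div h, zpow_add, zpow_add]
  rfl

/-- Compared with the next step of the path, `cycle z` differs by the displacement `cycleDiv z t`.
Moving it to the right of the path, where it acts at the base point, lowers both indices by `t + 1`.
-/
theorem cycle_mul_path (z : ℤ) (t : ℕ) :
    S.cycle e z * S.path e t = S.path e (t + 1) * S.cycleDiv e (z - t - 1) (-1) := by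
  have h1 := conj_cycleDiv h (path_hasDegree h (e := e) (t + 1)) (z - t - 1) (-1)
  rw [mul_inv_eq_iff_eq_mul] at h1
  rw [h1]
  push_cast
  rw [show (t : ℤ) + 1 + (z - t - 1) = z by ring, show (t : ℤ) + 1 + -1 = t by ring]
  simp [cycleDiv, path, mul_assoc]

theorem exists_hasDegree_apply_eq (hS : S.IsIndecomposable) (x : X) :
    ∃ g n, S.HasDegree e g n ∧ g e = x := by
  obtain ⟨g, hg⟩ := hS.exists_smul_eq e x
  obtain ⟨n, hn⟩ := exists_hasDegree h (e := e) g.2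
  exact ⟨g, n, hn, hg⟩

/-- Conjugation shifts the indices of a displacement by `m` steps along the cycle of `Ret(X)`, and
`cycle` is `m`-periodic. -/
theorem HasDegree.commute_dis (hS : S.IsIndecomposable) {m : ℕ} (hm : (S.stabDis e).index = m)
    {g : Equiv.Perm X} (hg : S.HasDegree e g m) {δ : Equiv.Perm X} (hδ : δ ∈ S.dis) :
    g * δ = δ * g := by
  have key : ∀ x, S.σPerm ((S.σPerm e ^ (m : ℤ)) x) = S.σPerm x := by
    intro x
    obtain ⟨f, n, hf, rfl⟩ := exists_hasDegree_apply_eq h (e := e) hS x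
    rw [hf.σPerm_apply_base h, ← Equiv.Perm.mul_apply,
      ((hasDegree_zpow e m).mul h hf).σPerm_apply_base h]
    exact cycle_periodic h hm (by simp)
  rw [← mul_inv_eq_iff_eq_mul, hg.conj h hδ]
  induction hδ using Subgroup.closure_induction with
  | mem δ hδ =>
    obtain ⟨x, y, rfl⟩ := hδ
    rw [conj_zpow_σPerm_div h, key, key]
  | one => simp
  | mul f g _ _ hf hg =>
    nth_rw 2 [← hf, ← hg]
    group
  | inv g _ hg =>
    nth_rw 2 [← hg]
    group

theorem exists_model_isIso {B : Type u} [AddCommGroup B] {m : ℕ} [NeZero m]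
    (hS : S.IsIndecomposable) (hm : (S.stabDis e).index = m) (ψ : S.dis →* Multiplicative B)
    (hψ : Function.Surjective ψ) (hker : ∀ δ, ψ δ = 1 ↔ (δ : Equiv.Perm X) e = e) :
    ∃ (d : ZMod m → B) (c : B), d 0 = 0 ∧ AddSubgroup.closure (Set.range d) = ⊤ ∧
      (model d c).IsIso S := by
  let v : S.dis → B := fun δ => Multiplicative.toAdd (ψ δ)
  have hv : ∀ b, ∃ δ, v δ = b := fun b => hψ (Multiplicative.ofAdd b)
  choose D hD using hv
  have hvmul : ∀ f g, v (f * g) = v f + v g := fun f g => by simp [v]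
  have hvinv : ∀ f, v f⁻¹ = - v f := fun f => by simp [v]
  have hveq : ∀ f g : S.dis, v f = v g ↔ (f : Equiv.Perm X) e = (g : Equiv.Perm X) e := by
    intro f g
    rw [← Equiv.Perm.eq_inv_iff_eq, eq_comm (a := e), ← Equiv.Perm.mul_apply]
    refine Iff.trans ?_ (hker (f⁻¹ * g))
    rw [map_mul, map_inv, inv_mul_eq_one]
    rfl
  -- The displacement in `cycle_mul_path` with `z - t` as argument; periodicity frees it from the
  -- choice of representative.
  let d : ZMod m → B := fun z => v (S.cycleDiv e (z.val - 1) (-1))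
  have hd : ∀ n : ℤ, d n = v (S.cycleDiv e (n - 1) (-1)) := by
    intro n
    simp only [d]
    congr 1
    refine Subtype.ext (congrArg (· * _) (cycle_periodic h hm ?_))
    rw [ZMod.val_intCast, sub_sub_sub_cancel_right, ← dvd_neg, neg_sub]
    exact Int.dvd_self_sub_emod
  have hpath : S.HasDegree e (S.path e m) m := path_hasDegree h m
  -- After `m` steps the path is back in the orbit of `e` but need not end at `e`; `c` measures the
  -- gap.
  obtain ⟨δ, hδ, hδ'⟩ := (hpath.apply_iff_dvd h hm).2 dvd_rfl
  let c : B := v ⟨δ, hδ⟩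
  refine ⟨d, c, ?_, ?_, ?_⟩
  · have := hd 0
    have h1 : S.cycleDiv e (0 - 1) (-1) = 1 := Subtype.ext (by simp [cycleDiv])
    rw [h1] at this
    simpa [v] using this
  · rw [eq_top_iff]
    intro b _
    obtain ⟨⟨f, hf⟩, rfl⟩ : ∃ f, v f = b := ⟨D b, hD b⟩
    induction hf using Subgroup.closure_induction with
    | mem f hf =>
      obtain ⟨x, y, rfl⟩ := hf
      obtain ⟨f, n, hf, rfl⟩ := exists_hasDegree_apply_eq h (e := e) hS x
      obtain ⟨g, k, hg, rfl⟩ := exists_hasDegree_apply_eq h (e := e) hS y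
      have h1 : v ⟨S.σPerm (f e) * (S.σPerm (g e))⁻¹, Subgroup.subset_closure ⟨_, _, rfl⟩⟩ =
          d (n + 1 : ℤ) - d (k + 1 : ℤ) := by
        rw [hd, hd, sub_eq_add_neg, ← hvinv, ← hvmul]
        congr 1
        refine Subtype.ext ?_
        simp [cycleDiv, hf.σPerm_apply_base h, hg.σPerm_apply_base h]
      refine h1 ▸ sub_mem ?_ ?_ <;> exact AddSubgroup.subset_closure ⟨_, rfl⟩
    | one => exact (show v 1 = 0 from by simp [v]) ▸ zero_mem _
    | mul f g hf hg hf' hg' =>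
      exact (hvmul ⟨f, hf⟩ ⟨g, hg⟩).symm ▸ add_mem (hf' trivial) (hg' trivial)
    | inv f hf hf' => exact (hvinv ⟨f, hf⟩).symm ▸ neg_mem (hf' trivial)
  -- First translate within the orbit of `e`, then follow the path to the orbit in position `x.2`.
  · let Ψ : B × ZMod m → X := fun x => S.path e x.2.val ((D x.1 : Equiv.Perm X) e)
    have hinj : Function.Injective Ψ := by
      rintro ⟨a, i⟩ ⟨b, j⟩ hab
      replace hab : S.path e i.val ((D a : Equiv.Perm X) e) =
        S.path e j.val ((D b : Equiv.Perm X) e) := hab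
      have hdeg : S.HasDegree e ((S.path e j.val)⁻¹ * S.path e i.val * D a)
          (-(j.val : ℤ) + i.val + 0) :=
        (((path_hasDegree h _).inv h).mul h (path_hasDegree h _)).mul h
          (hasDegree_of_mem_dis e (D a).2)
      have hdvd := (hdeg.apply_iff_dvd h hm).1 ⟨D b, (D b).2, by
        rw [Equiv.Perm.mul_apply, Equiv.Perm.mul_apply, Equiv.Perm.inv_eq_iff_eq, hab]⟩
      have hij : i = j := by
        have := (ZMod.intCast_zmod_eq_zero_iff_dvd _ m).2 hdvd
        push_cast at this
        simp only [ZMod.natCast_val, ZMod.cast_id', id, add_zero] at this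
        exact (neg_add_eq_zero.1 this).symm
      subst hij
      have := (hveq _ _).2 ((S.path e i.val).injective hab)
      rw [hD, hD] at this
      rw [this]
    have hsurj : Function.Surjective Ψ := by
      intro x
      obtain ⟨g, n, hg, rfl⟩ := exists_hasDegree_apply_eq h (e := e) hS x
      have hdeg := ((path_hasDegree h (e := e) (n : ZMod m).val).inv h).mul h hg
      obtain ⟨f, hf, hf'⟩ := (hdeg.apply_iff_dvd h hm).2 (by
        rw [ZMod.val_intCast, neg_add_eq_sub]
        exact Int.dvd_self_sub_emod)
      refine ⟨(v ⟨f, hf⟩, n), ?_⟩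
      simp only [Ψ]
      rw [(hveq (D _) ⟨f, hf⟩).1 (hD _), ← hf', ← Equiv.Perm.mul_apply]
      simp
    have hact : ∀ (f : S.dis) (a : B), (f : Equiv.Perm X) ((D a : Equiv.Perm X) e) =
        (D (a + v f) : Equiv.Perm X) e := by
      intro f a
      refine (hveq (f * D a) _).1 ?_
      rw [hvmul, hD, hD, add_comm]
    refine ⟨Equiv.ofBijective Ψ ⟨hinj, hsurj⟩, ?_⟩
    rintro ⟨b, i⟩ ⟨a, j⟩
    change S.path e (j + 1).val ((D (a + d (i - j) + wrap c j) : Equiv.Perm X) e) =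
      S.σPerm (Ψ (b, i)) (Ψ (a, j))
    have h1 : S.σPerm (Ψ (b, i)) = S.cycle e (i.val + 0 : ℤ) :=
      ((path_hasDegree h i.val).mul h (hasDegree_of_mem_dis e (D b).2)).σPerm_apply_base h
    have h2 := congrArg (fun g : Equiv.Perm X => g ((D a : Equiv.Perm X) e))
      (cycle_mul_path h (e := e) i.val j.val)
    simp only [Equiv.Perm.mul_apply] at h2
    rw [h1, add_zero, h2, hact, ← hd]
    push_cast
    simp only [ZMod.natCast_val, ZMod.cast_id', id]
    have hval : (j + 1).val = (j.val + 1) % m := by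
      rw [← ZMod.val_natCast]
      simp
    rcases lt_or_eq_of_le (Nat.succ_le_of_lt j.val_lt) with hlt | heq
    · have hj : j ≠ -1 := by
        rintro rfl
        rw [neg_add_cancel, ZMod.val_zero, Nat.mod_eq_of_lt hlt] at hval
        omega
      rw [hval, Nat.mod_eq_of_lt hlt, wrap, if_neg hj, add_zero]
    -- Wrap-around: the full path commutes with displacements, so its only effect on the orbit of
    -- `e` is translation by `c`.
    · have heq' : j.val + 1 = m := heq
      have hj : j = -1 := by
        rw [eq_neg_iff_add_eq_zero, ← ZMod.val_eq_zero, hval, heq', Nat.mod_self]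
      rw [hval, heq', Nat.mod_self, wrap, if_pos hj, ← Equiv.Perm.mul_apply (S.path e m),
        hpath.commute_dis h hS hm (D _).2, Equiv.Perm.mul_apply, hδ', ← hact ⟨δ, hδ⟩]
      exact congrArg (fun g : Equiv.Perm X => g e) (dis_commute h hδ (D _).2)

end Existence
end Solution
end YB

/-! ### Isomorphism classes as orbits of `Aut B` on the parameters. -/

namespace YB

section Classes

open Solution

/-- The parameters `(d, c)` of the models on `B × ZMod m`. -/
abbrev ModelData (B : Type u) [AddCommGroup B] (m : ℕ) : Type u :=
  {d : ZMod m → B // d 0 = 0 ∧ AddSubgroup.closure (Set.range d) = ⊤} × B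

variable {A : Type v} [AddCommGroup A] {B : Type u} [AddCommGroup B] {m : ℕ} [NeZero m]
  [Nontrivial B]

/-- The isomorphism class of the model with the given parameters. -/
def modelClass (φ : A ≃+ B) (x : ModelData B m) : IsoClasses.{u, v} A m :=
  Quotient.mk (isoSetoid A m)
    { X := B × ZMod m
      S := model x.1.1 x.2
      indec := model_isIndecomposable x.1.2.1 x.1.2.2
      level := model_isLevelTwo x.1.2.1 x.1.2.2
      inv := ⟨0, model_disQuotientIso φ x.1.2.1 x.1.2.2, model_index_stabDis x.1.2.1 x.1.2.2⟩ }

theorem modelClass_eq_iff [Finite B] (φ : A ≃+ B) (x y : ModelData B m) :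
    modelClass φ x = modelClass φ y ↔
      ∃ f : B ≃+ B, (∀ i, f (x.1.1 i) = y.1.1 i) ∧ f x.2 = y.2 :=
  Quotient.eq.trans ⟨fun h => exists_addEquiv_of_model_isIso x.1.2.1 y.1.2.1 x.1.2.2 y.1.2.2 h,
    fun ⟨f, hf, hf'⟩ => model_isIso f hf hf'⟩

theorem modelClass_surjective (φ : A ≃+ B) :
    Function.Surjective (modelClass (m := m) φ) := by
  rintro ⟨P⟩
  obtain ⟨e, ⟨_, ⟨θ⟩⟩, hm⟩ := P.inv
  let ψ : P.S.dis →* Multiplicative B :=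
    (θ.trans φ.toMultiplicative).toMonoidHom.comp
      (QuotientGroup.mk' (MulAction.stabilizer P.S.dis e))
  have hψ : Function.Surjective ψ :=
    (θ.trans φ.toMultiplicative).surjective.comp (QuotientGroup.mk'_surjective _)
  have hker : ∀ δ, ψ δ = 1 ↔ (δ : Equiv.Perm P.X) e = e := fun δ => by
    change (θ.trans φ.toMultiplicative) (QuotientGroup.mk' _ δ) = 1 ↔ _
    rw [EmbeddingLike.map_eq_one_iff, QuotientGroup.mk'_apply, QuotientGroup.eq_one_iff]
    rfl
  obtain ⟨d, c, h0, hd, hiso⟩ := exists_model_isIso P.level.2 P.indec hm ψ hψ hker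
  exact ⟨(⟨d, h0, hd⟩, c), Quotient.sound hiso⟩

/-- Automorphisms of `B` act simply transitively on the parameters of a class of models. -/
theorem nonempty_fiber_equiv [Finite B] (φ : A ≃+ B) (q : IsoClasses.{u, v} A m) :
    Nonempty ({x : ModelData B m // modelClass φ x = q} ≃ (B ≃+ B)) := by
  obtain ⟨x, rfl⟩ := modelClass_surjective φ q
  have hf : ∀ f : B ≃+ B, AddSubgroup.closure (Set.range (f ∘ x.1.1)) = ⊤ := fun f => by
    have h1 := AddMonoidHom.map_closure f.toAddMonoidHom (Set.range x.1.1)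
    rw [x.1.2.2, ← Set.range_comp] at h1
    refine h1.symm.trans ?_
    rw [← AddMonoidHom.range_eq_map, AddMonoidHom.range_eq_top]
    exact f.surjective
  let F : (B ≃+ B) → {y : ModelData B m // modelClass φ y = modelClass φ x} := fun f =>
    ⟨(⟨f ∘ x.1.1, by simp [x.1.2.1], hf f⟩, f x.2),
      ((modelClass_eq_iff φ _ _).2 ⟨f, fun _ => rfl, rfl⟩).symm⟩
  refine ⟨(Equiv.ofBijective F ⟨fun f g hfg => ?_, fun ⟨y, hy⟩ => ?_⟩).symm⟩
  · have h1 : f ∘ x.1.1 = g ∘ x.1.1 :=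
      congrArg (fun z : {y : ModelData B m // modelClass φ y = modelClass φ x} => z.1.1.1) hfg
    -- Freeness: automorphisms agreeing on the generating values of `d` coincide.
    have h2 : Set.EqOn f.toAddMonoidHom g.toAddMonoidHom (Set.range x.1.1) := by
      rintro _ ⟨i, rfl⟩
      exact congrFun h1 i
    have h3 := AddMonoidHom.eq_of_eqOn_dense x.1.2.2 h2
    exact AddEquiv.ext fun b => DFunLike.congr_fun h3 b
  · obtain ⟨f, hf, hf'⟩ := (modelClass_eq_iff φ _ _).1 hy.symm
    exact ⟨f, Subtype.ext (Prod.ext (Subtype.ext (funext hf)) hf')⟩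

theorem card_isoClasses_mul [Finite B] (φ : A ≃+ B) :
    Nat.card (IsoClasses.{u, v} A m) * Nat.card (B ≃+ B) =
      Nat.card {d : ZMod m → B // d 0 = 0 ∧ AddSubgroup.closure (Set.range d) = ⊤} *
        Nat.card B := by
  rw [← Nat.card_prod, ← Nat.card_prod]
  refine Nat.card_congr ?_
  exact (Equiv.sigmaEquivProd _ _).symm.trans ((Equiv.sigmaCongrRight fun q =>
    (nonempty_fiber_equiv φ q).some.symm).trans (Equiv.sigmaFiberEquiv (modelClass φ)))

end Classes

/-! ### Automorphisms and generating tuples of F_p^k. -/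

section Count

variable {p k : ℕ} [Fact p.Prime] {B : Type u} [AddCommGroup B]

theorem nonempty_addEquiv_pi {A : Type v} [AddCommGroup A] [Finite A] [Module (ZMod p) A]
    (hcard : Nat.card A = p ^ k) : Nonempty (A ≃+ (Fin k → ZMod p)) := by
  have hrank : Module.finrank (ZMod p) A = k := Nat.pow_right_injective (Fact.out : p.Prime).two_le
    ((FiniteField.pow_finrank_eq_natCard p A).trans hcard)
  have b : Module.Basis (Fin k) (ZMod p) A := Module.finBasisOfFinrankEq (ZMod p) A hrank
  exact ⟨b.equivFun.toAddEquiv⟩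

theorem card_addAut (e : B ≃+ (Fin k → ZMod p)) :
    Nat.card (B ≃+ B) = ∏ i : Fin k, (p ^ k - p ^ (i : ℕ)) := by
  have h1 : (B ≃+ B) ≃ ((Fin k → ZMod p) ≃+ (Fin k → ZMod p)) := (AddAut.congr e).toEquiv
  have h2 : ((Fin k → ZMod p) ≃+ (Fin k → ZMod p)) ≃
      ((Fin k → ZMod p) ≃ₗ[ZMod p] (Fin k → ZMod p)) :=
    { toFun := fun f => { f with map_smul' := ZMod.map_smul f }
      invFun := fun f => f.toAddEquiv
      left_inv := fun _ => rfl
      right_inv := fun _ => rfl }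
  have h3 : Matrix.GeneralLinearGroup (Fin k) (ZMod p) ≃
      ((Fin k → ZMod p) ≃ₗ[ZMod p] (Fin k → ZMod p)) :=
    (Matrix.GeneralLinearGroup.toLin.trans
      (LinearMap.GeneralLinearGroup.generalLinearEquiv _ _)).toEquiv
  rw [Nat.card_congr (h1.trans (h2.trans h3.symm)), Matrix.card_GL_field, ZMod.card]

/-- Over F_p additive generation is linear spanning, and `d 0 = 0` contributes nothing. The
remaining `n` vectors are the rows of a matrix; they span iff its rank is `k`, iff its `k` columns
are independent. -/
theorem closure_eq_top_iff_linearIndependent {n : ℕ} (e : B ≃+ (Fin k → ZMod p))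
    (d : Fin (n + 1) → B) (h0 : d 0 = 0) :
    AddSubgroup.closure (Set.range d) = ⊤ ↔
      LinearIndependent (ZMod p) (fun (i : Fin k) (j : Fin n) => e (d j.succ) i) := by
  have h1 : AddSubgroup.closure (Set.range d) = ⊤ ↔
      AddSubgroup.closure (Set.range (e ∘ d)) = ⊤ := by
    rw [Set.range_comp]
    change _ ↔ AddSubgroup.closure (e.toAddMonoidHom '' _) = ⊤
    rw [← AddMonoidHom.map_closure, ← (AddSubgroup.map_injective
      (f := e.toAddMonoidHom) e.injective).eq_iff, ← AddMonoidHom.range_eq_map,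
      AddMonoidHom.range_eq_top.2 e.surjective]
  have h2 : AddSubgroup.closure (Set.range (e ∘ d)) = ⊤ ↔
      Submodule.span (ZMod p) (Set.range (e ∘ d)) = ⊤ := by
    constructor
    · intro h
      have : AddSubgroup.closure (Set.range (e ∘ d)) ≤
          (Submodule.span (ZMod p) (Set.range (e ∘ d))).toAddSubgroup :=
        (AddSubgroup.closure_le _).2 Submodule.subset_span
      rw [h, top_le_iff] at this
      exact Submodule.toAddSubgroup_injective this
    · intro h
      have : Submodule.span (ZMod p) (Set.range (e ∘ d)) ≤ AddSubgroup.toZModSubmodule p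
          (AddSubgroup.closure (Set.range (e ∘ d))) :=
        Submodule.span_le.2 AddSubgroup.subset_closure
      rw [h, top_le_iff] at this
      rw [eq_top_iff]
      intro x _
      exact (AddSubgroup.mem_toZModSubmodule p).1 (this.symm ▸ Submodule.mem_top (x := x))
  have h3 : Set.range (e ∘ d) = insert 0 (Set.range fun j : Fin n => e (d j.succ)) := by
    ext x
    simp [Fin.exists_fin_succ, h0, eq_comm]
  rw [h1, h2, h3, Submodule.span_insert_zero, linearIndependent_iff_card_eq_finrank_span,
    Fintype.card_fin]
  let M : Matrix (Fin n) (Fin k) (ZMod p) := Matrix.of fun j => e (d j.succ)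
  have h4 : Set.finrank (ZMod p) (Set.range fun (i : Fin k) (j : Fin n) => e (d j.succ) i) =
      Module.finrank (ZMod p) (Submodule.span (ZMod p)
        (Set.range fun j : Fin n => e (d j.succ))) :=
    (M.rank_eq_finrank_span_cols).symm.trans M.rank_eq_finrank_span_row
  rw [h4]
  constructor
  · intro h
    rw [h, finrank_top, Module.finrank_fin_fun]
  · intro h
    refine Submodule.eq_top_of_finrank_eq ?_
    rw [← h, Module.finrank_fin_fun]

/-- Generating tuples of an elementary abelian group as linearly independent tuples. -/
def generatingEquiv (n : ℕ) (e : B ≃+ (Fin k → ZMod p)) :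
    {d : ZMod (n + 1) → B // d 0 = 0 ∧ AddSubgroup.closure (Set.range d) = ⊤} ≃
      {s : Fin k → (Fin n → ZMod p) // LinearIndependent (ZMod p) s} where
  -- `ZMod (n + 1)` is `Fin (n + 1)` by definition, so `Fin.succ` lists the indices other than 0.
  toFun d := ⟨fun i j => e (d.1 (Fin.succ j)) i,
    (closure_eq_top_iff_linearIndependent e d.1 d.2.1).1 d.2.2⟩
  invFun s := ⟨Fin.cons 0 fun j => e.symm fun i => s.1 i j, rfl,
    (closure_eq_top_iff_linearIndependent e _ rfl).2 (by
      change LinearIndependent _ fun i j => e (e.symm fun i => s.1 i j) i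
      simp only [e.apply_symm_apply]
      exact s.2)⟩
  left_inv d := by
    refine Subtype.ext (funext fun j => ?_)
    refine Fin.cases ?_ (fun j => ?_) j
    · exact d.2.1.symm
    · exact e.symm_apply_apply _
  right_inv s := by
    refine Subtype.ext (funext fun i => funext fun j => ?_)
    exact congrFun (e.apply_symm_apply _) i

end Count

/-! ### The quotient of the two counts as a Gaussian binomial coefficient. -/

section Arithmetic

theorem prod_pow_sub_mul (x : ℚ) (k r : ℕ) :
    (∏ i ∈ Finset.range k, (x ^ (k + r) - x ^ i)) * ∏ i ∈ Finset.Icc 1 r, (x ^ i - 1) =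
      (∏ i ∈ Finset.range k, x ^ i) * ∏ i ∈ Finset.Icc 1 (k + r), (x ^ i - 1) := by
  induction k generalizing r with
  | zero => simp
  | succ k ih =>
    -- The last factor is x^(k+1+r) - x^k = x^k (x^(r+1) - 1), which moves into the second product.
    have h1 := ih (r + 1)
    rw [Finset.prod_Icc_succ_top (by omega)] at h1
    rw [Finset.prod_range_succ, Finset.prod_range_succ, show k + 1 + r = k + (r + 1) by ring,
      mul_right_comm _ (x ^ k), ← h1]
    ring

theorem eq_of_mul_prod_pow_sub {p k r : ℕ} (hp : 1 < p) {N : ℕ}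
    (hN : N * ∏ i : Fin k, (p ^ k - p ^ (i : ℕ)) =
      (∏ i : Fin k, (p ^ (k + r) - p ^ (i : ℕ))) * p ^ k) :
    (N : ℚ) = (p : ℚ) ^ k * ((∏ i ∈ Finset.Icc (k + 1) (k + r), ((p : ℚ) ^ i - 1)) /
      ∏ i ∈ Finset.Icc 1 r, ((p : ℚ) ^ i - 1)) := by
  have hcast : ∀ n, k ≤ n → ((∏ i : Fin k, (p ^ n - p ^ (i : ℕ)) : ℕ) : ℚ) =
      ∏ i ∈ Finset.range k, ((p : ℚ) ^ n - (p : ℚ) ^ i) := by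
    intro n hn
    rw [Fin.prod_univ_eq_prod_range (fun i => p ^ n - p ^ i) k, Nat.cast_prod]
    refine Finset.prod_congr rfl fun i hi => ?_
    have : i ≤ n := (Finset.mem_range.1 hi).le.trans hn
    rw [Nat.cast_sub (Nat.pow_le_pow_right (by omega) this)]
    push_cast
    rfl
  have hN' := congrArg (Nat.cast : ℕ → ℚ) hN
  rw [Nat.cast_mul, Nat.cast_mul, hcast k le_rfl, hcast (k + r) (by omega), Nat.cast_pow] at hN'
  have hp' : (1 : ℚ) < p := by exact_mod_cast hp
  have hpos : ∀ n, (∏ i ∈ Finset.Icc 1 n, ((p : ℚ) ^ i - 1)) ≠ 0 := fun n =>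
    Finset.prod_ne_zero_iff.2 fun i hi => by
      have := one_lt_pow₀ hp' (n := i) (by have := (Finset.mem_Icc.1 hi).1; omega)
      linarith
  have hR : (∏ i ∈ Finset.range k, (p : ℚ) ^ i) ≠ 0 :=
    Finset.prod_ne_zero_iff.2 fun i _ => pow_ne_zero _ (by positivity)
  have h1 := prod_pow_sub_mul (p : ℚ) k r
  -- The case `r = 0` evaluates the order of GL_k(F_p).
  have h2 := prod_pow_sub_mul (p : ℚ) k 0
  simp only [add_zero, Finset.Icc_eq_empty_of_lt zero_lt_one, Finset.prod_empty, mul_one] at h2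
  have h3 : (∏ i ∈ Finset.Icc 1 k, ((p : ℚ) ^ i - 1)) *
      ∏ i ∈ Finset.Icc (k + 1) (k + r), ((p : ℚ) ^ i - 1) =
      ∏ i ∈ Finset.Icc 1 (k + r), ((p : ℚ) ^ i - 1) := by
    have := Finset.prod_Ioc_consecutive (fun i => (p : ℚ) ^ i - 1) (Nat.zero_le k)
      (Nat.le_add_right k r)
    simpa only [← Finset.Icc_add_one_left_eq_Ioc, zero_add] using this
  rw [h2] at hN'
  rw [mul_div_assoc', eq_div_iff (hpos r)]
  refine mul_left_cancel₀ (mul_ne_zero hR (hpos k)) ?_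
  linear_combination (∏ i ∈ Finset.Icc 1 r, ((p : ℚ) ^ i - 1)) * hN' + (p : ℚ) ^ k * h1 -
    (p : ℚ) ^ k * (∏ i ∈ Finset.range k, (p : ℚ) ^ i) * h3

end Arithmetic

end YB

theorem mainTheorem8 (p k m : ℕ) (hp : p.Prime) (hk : 1 ≤ k) (hm : 1 ≤ m)
    (A : Type v) [AddCommGroup A] (hA : ∀ a : A, p • a = 0) (hcard : Nat.card A = p ^ k) :
    Finite (YB.IsoClasses.{u, v} A m) ∧
    (k + 1 < m →
      (Nat.card (YB.IsoClasses.{u, v} A m) : ℚ) =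
        (p : ℚ) ^ k * ((∏ i ∈ Finset.Icc (k + 1) (m - 1), ((p : ℚ) ^ i - 1)) /
          (∏ i ∈ Finset.Icc 1 (m - k - 1), ((p : ℚ) ^ i - 1)))) ∧
    (m = k + 1 → Nat.card (YB.IsoClasses.{u, v} A m) = p ^ k) ∧
    (m ≤ k → Nat.card (YB.IsoClasses.{u, v} A m) = 0) := by
  have : Fact p.Prime := ⟨hp⟩
  have : Finite A := Nat.finite_of_card_ne_zero (hcard ▸ pow_ne_zero _ hp.ne_zero)
  let _ : Module (ZMod p) A := AddCommGroup.zmodModule hA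
  obtain ⟨ε⟩ := YB.nonempty_addEquiv_pi (p := p) hcard
  -- The underlying sets of the models must lie in universe `u`, whereas `A` lies in `v`.
  let B := ULift.{u} (Fin k → ZMod p)
  let e : B ≃+ (Fin k → ZMod p) := AddEquiv.ulift
  let φ : A ≃+ B := ε.trans e.symm
  have : NeZero m := ⟨by omega⟩
  have : NeZero k := ⟨by omega⟩
  have hcardB : Nat.card B = p ^ k := by rw [← hcard, Nat.card_congr φ.toEquiv]
  have : Nontrivial B := e.toEquiv.nontrivial
  have hfin : Finite (YB.IsoClasses.{u, v} A m) :=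
    Finite.of_surjective _ (YB.modelClass_surjective φ)
  obtain ⟨n, rfl⟩ : ∃ n, m = n + 1 := ⟨m - 1, by omega⟩
  have key := YB.card_isoClasses_mul (m := n + 1) φ
  rw [YB.card_addAut e, hcardB, Nat.card_congr (YB.generatingEquiv n e)] at key
  have hkey : k ≤ n → ∀ N, N = Nat.card (YB.IsoClasses.{u, v} A (n + 1)) →
      N * ∏ i : Fin k, (p ^ k - p ^ (i : ℕ)) = (∏ i : Fin k, (p ^ n - p ^ (i : ℕ))) * p ^ k := by
    rintro hkn N rfl
    rw [key, card_linearIndependent (by simpa using hkn)]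
    simp
  have hprod : ∏ i : Fin k, (p ^ k - p ^ (i : ℕ)) ≠ 0 :=
    Finset.prod_ne_zero_iff.2 fun i _ =>
      (Nat.sub_pos_of_lt (Nat.pow_lt_pow_right hp.one_lt i.2)).ne'
  refine ⟨hfin, fun hkm => ?_, fun hkm => ?_, fun hkm => ?_⟩
  · obtain ⟨r, rfl⟩ : ∃ r, n = k + r := ⟨n - k, by omega⟩
    rw [show k + r + 1 - 1 = k + r by omega, show k + r + 1 - k - 1 = r by omega]
    exact YB.eq_of_mul_prod_pow_sub hp.one_lt (hkey (by omega) _ rfl)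
  -- Here the generating tuples are the bases, as many as there are automorphisms, so only the
  -- choice of `c` remains.
  · obtain rfl : n = k := by omega
    have := hkey le_rfl _ rfl
    rw [mul_comm] at this
    exact Nat.eq_of_mul_eq_mul_left (Nat.pos_of_ne_zero hprod) this
  -- Now `n = m - 1 < k`, too small a dimension for `k` independent vectors.
  · have hempty : IsEmpty {s : Fin k → (Fin n → ZMod p) // LinearIndependent (ZMod p) s} := by
      refine ⟨fun s => ?_⟩
      have := s.2.fintype_card_le_finrank
      simp only [Fintype.card_fin, Module.finrank_fin_fun] at this
      omega
    rw [Nat.card_of_isEmpty (α := {s : Fin k → (Fin n → ZMod p) // _}), zero_mul] at key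
    exact (Nat.mul_eq_zero.1 key).resolve_right hprod
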